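/- **Gödel's System T.** The types of System T are generated by $A ::= nat \mid A \to B$. System T is the simply typed $\lambda$-calculus (terms $x$, $u\,v$, $\lambda x{:}A\;u$) extended with a constant $0 : nat$, a unary symbol $S$ ($S(n) : nat$ if $n : nat$), and for each type $A$ a ternary symbol $Rec^A$ ($Rec^A(a,f,n) : A$ if $a : A$, $f : nat \to A \to A$, $n : nat$). Its one-step reduction $\longrightarrow^1$ is the closure under all contexts of $$(\lambda x{:}A\;u)\,v \longrightarrow (v/x)u,\qquad Rec^A(a,f,0) \longrightarrow a,\qquad Rec^A(a,f,S(b)) \longrightarrow f\;b\;Rec^A(a,f,b).$$ **The theory $\mathcal T$.** $\mathcal T$ is the theory in intuitionistic natural deduction modulo, without axioms, whose one-sorted language has a constant $nat$, a binary function symbol $\to$ and a unary predicate symbol $\varepsilon$, and whose congruence $\equiv$ on propositions is generated by the rewrite rules $$\varepsilon(nat) \longrightarrow \forall p\,\bigl(\varepsilon(p) \Rightarrow (\varepsilon(nat) \Rightarrow \varepsilon(p) \Rightarrow \varepsilon(p)) \Rightarrow \varepsilon(p)\bigr),\qquad \varepsilon(y \to z) \longrightarrow \varepsilon(y) \Rightarrow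 \varepsilon(z).$$ All the usual rules for $\Rightarrow,\wedge,\vee,\top,\bot,\forall,\exists$ are available, each applied up to $\equiv$. Proofs are written as proof-terms (with $\lambda\alpha{:}A\;\pi$ and $(\pi\,\pi')$ for $\Rightarrow$, $\lambda x\,\pi$ and $(\pi\,t)$ for $\forall$, and the usual constructions for the other connectives). Proof reduction is the closure under all contexts of the cut-elimination rules: an elimination applied to the corresponding introduction reduces by $\beta$, projection, case analysis or substitution. Every type of System T is a closed term of $\mathcal T$. **Translation (Parigot numerals).** Each term $t$ of System T is mapped to a proof-term $|t|$ by - $|x| = x$, $\;|u\,v| = |u|\,|v|$, $\;|\lambda x{:}A\;u| = \lambda x{:}\varepsilon(A)\;|u|$, - $|0| = \lambda p\,\lambda x{:}\varepsilon(p)\,\lambda f{:}\varepsilon(nat) \Rightarrow \varepsilon(p) \Rightarrow \varepsilon(p)\;\; x$, - $|S(n)| = \lambda p\,\lambda x{:}\varepsilon(p)\,\lambda f{:}\varepsilon(nat) \Rightarrow \varepsilon(p) \Rightarrow \varepsilon(p)\;\; (f\;|n|\;(|n|\;p\;x\;f))$, - $|Rec^A(a,f,n)| = (|n|\;A\;|a|\;|f|)$.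 **Theorem.** 1. If $x_1{:}A_1,\dots,x_n{:}A_n \vdash t : A$ in System T, then $|t|$ is a proof of $\varepsilon(A)$ under the hypotheses $x_1{:}\varepsilon(A_1),\dots,x_n{:}\varepsilon(A_n)$ in $\mathcal T$. 2. If $t \longrightarrow^1 u$ in System T, then $|t| \longrightarrow^+ |u|$ (at least one step of proof reduction). 3. Consequently, if $|t|$ is strongly normalizing then so is $t$; and if every proof in $\mathcal T$ is strongly normalizing, then every typed term of System T is strongly normalizing. 4. Every typed term of System T is strongly normalizing. -/

import Mathlib

/-! Natural deduction modulo with proof-terms for the theory with the two rewrite rules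
`ε(nat) → ∀ p (ε(p) ⇒ (ε(nat) ⇒ ε(p) ⇒ ε(p)) ⇒ ε(p))` and `ε(y → z) → ε(y) ⇒ ε(z)`,
the System T of Gödel, and the translation of the latter into the former.
Bound variables are de Bruijn indices. In propositions the indices refer to term variables;
in proof-terms, term variables and proof variables are numbered separately. -/

/-- Strong normalization of `x` for the reduction relation `r`:
there is no infinite sequence of `r`-steps from `x`. -/
def StronglyNormalizing {α : Type} (r : α → α → Prop) (x : α) : Prop :=
  Acc (fun b a => r a b) x

namespace TheoryT

/-- Terms of the (one-sorted) language of the theory. -/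
inductive Term : Type
  | var (n : ℕ)
  | nat
  | arr (y z : Term)

namespace Term

/-- Simultaneous substitution in terms (terms have no binders). -/
def subst (τ : ℕ → Term) : Term → Term
  | var n => τ n
  | nat => nat
  | arr y z => arr (subst τ y) (subst τ z)

/-- The substitution that shifts all variables by one. -/
def shift (n : ℕ) : Term := var (n + 1)

/-- Lifting of a substitution under a binder. -/
def lift (τ : ℕ → Term) : ℕ → Term
  | 0 => var 0
  | n + 1 => (τ n).subst shift

/-- The substitution `(t/x)` for the last bound variable `x`. -/
def inst (t : Term) : ℕ → Term
  | 0 => t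
  | n + 1 => var n

end Term

/-- Propositions. The unary predicate `ε` is the only predicate symbol. -/
inductive Form : Type
  | eps (t : Term)
  | top
  | bot
  | imp (A B : Form)
  | and (A B : Form)
  | or (A B : Form)
  | all (A : Form)
  | ex (A : Form)

namespace Form

/-- Simultaneous substitution of terms in propositions. -/
def subst (τ : ℕ → Term) : Form → Form
  | eps t => eps (t.subst τ)
  | top => top
  | bot => bot
  | imp A B => imp (subst τ A) (subst τ B)
  | and A B => and (subst τ A) (subst τ B)
  | or A B => or (subst τ A) (subst τ B)
  | all A => all (subst (Term.lift τ) A)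
  | ex A => ex (subst (Term.lift τ) A)

/-- The proposition `A` in a language context with one more term variable. -/
def shift (A : Form) : Form := A.subst Term.shift

/-- The proposition `ε(nat) ⇒ ε(p) ⇒ ε(p)`. -/
def stepForm (p : Term) : Form := imp (eps .nat) (imp (eps p) (eps p))

/-- The right-hand side `∀ p (ε(p) ⇒ (ε(nat) ⇒ ε(p) ⇒ ε(p)) ⇒ ε(p))` of the rule for `nat`. -/
def natForm : Form :=
  all (imp (eps (.var 0)) (imp (stepForm (.var 0)) (eps (.var 0))))

/-- One-step rewriting of propositions: closure under all contexts of the two rewrite rules. -/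
inductive Rewrite : Form → Form → Prop
  | nat : Rewrite (eps .nat) natForm
  | arr (y z : Term) : Rewrite (eps (.arr y z)) (imp (eps y) (eps z))
  | imp_left {A A' : Form} (B : Form) : Rewrite A A' → Rewrite (imp A B) (imp A' B)
  | imp_right (A : Form) {B B' : Form} : Rewrite B B' → Rewrite (imp A B) (imp A B')
  | and_left {A A' : Form} (B : Form) : Rewrite A A' → Rewrite (and A B) (and A' B)
  | and_right (A : Form) {B B' : Form} : Rewrite B B' → Rewrite (and A B) (and A B')
  | or_left {A A' : Form} (B : Form) : Rewrite A A' → Rewrite (or A B) (or A' B)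
  | or_right (A : Form) {B B' : Form} : Rewrite B B' → Rewrite (or A B) (or A B')
  | all {A A' : Form} : Rewrite A A' → Rewrite (all A) (all A')
  | ex {A A' : Form} : Rewrite A A' → Rewrite (ex A) (ex A')

/-- The congruence `≡` on propositions generated by the rewrite rules. -/
def Equiv : Form → Form → Prop := Relation.EqvGen Rewrite

end Form

/-- Proof-terms. An abstraction over a proof variable carries the proposition of that variable. -/
inductive Proof : Type
  /-- `α` -/
  | var (n : ℕ)
  /-- `λ α : A. π`, binds one proof variable -/
  | lam (A : Form) (π : Proof)
  /-- `(π π')` -/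
  | app (π π' : Proof)
  /-- `⟨π, π'⟩` -/
  | pair (π π' : Proof)
  | fst (π : Proof)
  | snd (π : Proof)
  /-- `i(π)` -/
  | inl (π : Proof)
  /-- `j(π)` -/
  | inr (π : Proof)
  /-- `δ(π₁, α π₂, β π₃)`, binds one proof variable in each of `π₂`, `π₃` -/
  | cases (π₁ π₂ π₃ : Proof)
  /-- `I`, the proof of truth -/
  | triv
  /-- `δ_⊥(π)` -/
  | absurd (π : Proof)
  /-- `λ x. π`, binds one term variable -/
  | tlam (π : Proof)
  /-- `(π t)` -/
  | tapp (π : Proof) (t : Term)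
  /-- `⟨t, π⟩` -/
  | tpair (t : Term) (π : Proof)
  /-- `δ_∃(π, x α π')`, binds one term variable and one proof variable in `π'` -/
  | unpack (π π' : Proof)

namespace Proof

/-- Lifting of a renaming under a binder. -/
def liftRen (s : ℕ → ℕ) : ℕ → ℕ
  | 0 => 0
  | n + 1 => s n + 1

/-- Simultaneous substitution `τ` of the term variables and renaming `s` of the proof variables. -/
def rename : (ℕ → Term) → (ℕ → ℕ) → Proof → Proof
  | _, s, var n => var (s n)
  | τ, s, lam A π => lam (A.subst τ) (rename τ (liftRen s) π)
  | τ, s, app π π' => app (rename τ s π) (rename τ s π')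
  | τ, s, pair π π' => pair (rename τ s π) (rename τ s π')
  | τ, s, fst π => fst (rename τ s π)
  | τ, s, snd π => snd (rename τ s π)
  | τ, s, inl π => inl (rename τ s π)
  | τ, s, inr π => inr (rename τ s π)
  | τ, s, cases π₁ π₂ π₃ =>
      cases (rename τ s π₁) (rename τ (liftRen s) π₂) (rename τ (liftRen s) π₃)
  | _, _, triv => triv
  | τ, s, absurd π => absurd (rename τ s π)
  | τ, s, tlam π => tlam (rename (Term.lift τ) s π)
  | τ, s, tapp π t => tapp (rename τ s π) (t.subst τ)
  | τ, s, tpair t π => tpair (t.subst τ) (rename τ s π)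
  | τ, s, unpack π π' => unpack (rename τ s π) (rename (Term.lift τ) (liftRen s) π')

/-- Lifting of a proof substitution under the binder of a proof variable. -/
def lift (σ : ℕ → Proof) : ℕ → Proof
  | 0 => var 0
  | n + 1 => (σ n).rename Term.var Nat.succ

/-- Lifting of a proof substitution under the binder of a term variable. -/
def tlift (σ : ℕ → Proof) (n : ℕ) : Proof := (σ n).rename Term.shift id

/-- Simultaneous substitution `τ` of the term variables and `σ` of the proof variables. -/
def subst : (ℕ → Term) → (ℕ → Proof) → Proof → Proof
  | _, σ, var n => σ n
  | τ, σ, lam A π => lam (A.subst τ) (subst τ (lift σ) π)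
  | τ, σ, app π π' => app (subst τ σ π) (subst τ σ π')
  | τ, σ, pair π π' => pair (subst τ σ π) (subst τ σ π')
  | τ, σ, fst π => fst (subst τ σ π)
  | τ, σ, snd π => snd (subst τ σ π)
  | τ, σ, inl π => inl (subst τ σ π)
  | τ, σ, inr π => inr (subst τ σ π)
  | τ, σ, cases π₁ π₂ π₃ => cases (subst τ σ π₁) (subst τ (lift σ) π₂) (subst τ (lift σ) π₃)
  | _, _, triv => triv
  | τ, σ, absurd π => absurd (subst τ σ π)
  | τ, σ, tlam π => tlam (subst (Term.lift τ) (tlift σ) π)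
  | τ, σ, tapp π t => tapp (subst τ σ π) (t.subst τ)
  | τ, σ, tpair t π => tpair (t.subst τ) (subst τ σ π)
  | τ, σ, unpack π π' => unpack (subst τ σ π) (subst (Term.lift τ) (lift (tlift σ)) π')

/-- The substitution `(π/α)` for the last bound proof variable `α`. -/
def inst (π : Proof) : ℕ → Proof
  | 0 => π
  | n + 1 => var n

/-- One-step proof reduction `▷`: closure under all contexts of the cut-elimination rules. -/
inductive Step : Proof → Proof → Prop
  | beta (A : Form) (π₁ π₂ : Proof) :
      Step (app (lam A π₁) π₂) (π₁.subst Term.var (inst π₂))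
  | tbeta (π : Proof) (t : Term) : Step (tapp (tlam π) t) (π.subst (Term.inst t) var)
  | fst_pair (π₁ π₂ : Proof) : Step (fst (pair π₁ π₂)) π₁
  | snd_pair (π₁ π₂ : Proof) : Step (snd (pair π₁ π₂)) π₂
  | cases_inl (π₁ π₂ π₃ : Proof) :
      Step (cases (inl π₁) π₂ π₃) (π₂.subst Term.var (inst π₁))
  | cases_inr (π₁ π₂ π₃ : Proof) :
      Step (cases (inr π₁) π₂ π₃) (π₃.subst Term.var (inst π₁))
  | unpack_tpair (t : Term) (π₁ π₂ : Proof) :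
      Step (unpack (tpair t π₁) π₂) (π₂.subst (Term.inst t) (inst π₁))
  | lam_congr (A : Form) {π ρ : Proof} : Step π ρ → Step (lam A π) (lam A ρ)
  | app_left {π ρ : Proof} (π' : Proof) : Step π ρ → Step (app π π') (app ρ π')
  | app_right (π' : Proof) {π ρ : Proof} : Step π ρ → Step (app π' π) (app π' ρ)
  | pair_left {π ρ : Proof} (π' : Proof) : Step π ρ → Step (pair π π') (pair ρ π')
  | pair_right (π' : Proof) {π ρ : Proof} : Step π ρ → Step (pair π' π) (pair π' ρ)
  | fst_congr {π ρ : Proof} : Step π ρ → Step (fst π) (fst ρ)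
  | snd_congr {π ρ : Proof} : Step π ρ → Step (snd π) (snd ρ)
  | inl_congr {π ρ : Proof} : Step π ρ → Step (inl π) (inl ρ)
  | inr_congr {π ρ : Proof} : Step π ρ → Step (inr π) (inr ρ)
  | cases_fst {π ρ : Proof} (π₂ π₃ : Proof) :
      Step π ρ → Step (cases π π₂ π₃) (cases ρ π₂ π₃)
  | cases_snd (π₁ : Proof) {π ρ : Proof} (π₃ : Proof) :
      Step π ρ → Step (cases π₁ π π₃) (cases π₁ ρ π₃)
  | cases_thd (π₁ π₂ : Proof) {π ρ : Proof} :
      Step π ρ → Step (cases π₁ π₂ π) (cases π₁ π₂ ρ)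
  | absurd_congr {π ρ : Proof} : Step π ρ → Step (absurd π) (absurd ρ)
  | tlam_congr {π ρ : Proof} : Step π ρ → Step (tlam π) (tlam ρ)
  | tapp_congr {π ρ : Proof} (t : Term) : Step π ρ → Step (tapp π t) (tapp ρ t)
  | tpair_congr (t : Term) {π ρ : Proof} : Step π ρ → Step (tpair t π) (tpair t ρ)
  | unpack_left {π ρ : Proof} (π' : Proof) : Step π ρ → Step (unpack π π') (unpack ρ π')
  | unpack_right (π' : Proof) {π ρ : Proof} : Step π ρ → Step (unpack π' π) (unpack π' ρ)

end Proof

/-- `Proves Γ π A`: the proof-term `π` is a proof of `A` under the hypotheses `Γ`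
in intuitionistic natural deduction modulo the congruence of the theory (which has no axioms).
Hypothesis number `n` of the list `Γ` is named by the proof variable `n`. -/
inductive Proves : List Form → Proof → Form → Prop
  | ax {Γ : List Form} {n : ℕ} {A B : Form} :
      Γ[n]? = some A → Form.Equiv A B → Proves Γ (.var n) B
  | imp_intro {Γ : List Form} {π : Proof} {A B C : Form} :
      Proves (A :: Γ) π B → Form.Equiv C (.imp A B) → Proves Γ (.lam A π) C
  | imp_elim {Γ : List Form} {π π' : Proof} {A B C : Form} :
      Proves Γ π C → Proves Γ π' A → Form.Equiv C (.imp A B) → Proves Γ (.app π π') B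
  | and_intro {Γ : List Form} {π π' : Proof} {A B C : Form} :
      Proves Γ π A → Proves Γ π' B → Form.Equiv C (.and A B) → Proves Γ (.pair π π') C
  | and_left {Γ : List Form} {π : Proof} {A B C : Form} :
      Proves Γ π C → Form.Equiv C (.and A B) → Proves Γ (.fst π) A
  | and_right {Γ : List Form} {π : Proof} {A B C : Form} :
      Proves Γ π C → Form.Equiv C (.and A B) → Proves Γ (.snd π) B
  | or_left {Γ : List Form} {π : Proof} {A B C : Form} :
      Proves Γ π A → Form.Equiv C (.or A B) → Proves Γ (.inl π) C
  | or_right {Γ : List Form} {π : Proof} {A B C : Form} :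
      Proves Γ π B → Form.Equiv C (.or A B) → Proves Γ (.inr π) C
  | or_elim {Γ : List Form} {π₁ π₂ π₃ : Proof} {A B C D : Form} :
      Proves Γ π₁ D → Proves (A :: Γ) π₂ C → Proves (B :: Γ) π₃ C → Form.Equiv D (.or A B) →
      Proves Γ (.cases π₁ π₂ π₃) C
  | top_intro {Γ : List Form} {A : Form} : Form.Equiv A .top → Proves Γ .triv A
  | bot_elim {Γ : List Form} {π : Proof} {A B : Form} :
      Proves Γ π B → Form.Equiv B .bot → Proves Γ (.absurd π) A
  | all_intro {Γ : List Form} {π : Proof} {A B : Form} :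
      Proves (Γ.map Form.shift) π A → Form.Equiv B (.all A) → Proves Γ (.tlam π) B
  | all_elim {Γ : List Form} {π : Proof} {A B C : Form} {t : Term} :
      Proves Γ π B → Form.Equiv B (.all A) → Form.Equiv C (A.subst (Term.inst t)) →
      Proves Γ (.tapp π t) C
  | ex_intro {Γ : List Form} {π : Proof} {A B C : Form} {t : Term} :
      Proves Γ π C → Form.Equiv B (.ex A) → Form.Equiv C (A.subst (Term.inst t)) →
      Proves Γ (.tpair t π) B
  | ex_elim {Γ : List Form} {π π' : Proof} {A B C : Form} :
      Proves Γ π C → Proves (A :: Γ.map Form.shift) π' B.shift → Form.Equiv C (.ex A) →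
      Proves Γ (.unpack π π') B

end TheoryT

namespace SystemT

/-- Types of System T. -/
inductive Ty : Type
  | nat
  | arr (A B : Ty)

/-- Terms of System T: simply typed lambda-calculus with `0`, `S` and `Rec^A`. -/
inductive Tm : Type
  | var (n : ℕ)
  | app (u v : Tm)
  /-- `λ x : A. u` -/
  | lam (A : Ty) (u : Tm)
  | zero
  | succ (n : Tm)
  /-- `Rec^A(a, f, n)` -/
  | recur (A : Ty) (a f n : Tm)

namespace Tm

/-- Renaming of variables. -/
def rename : (ℕ → ℕ) → Tm → Tm
  | s, var n => var (s n)
  | s, app u v => app (rename s u) (rename s v)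
  | s, lam A u => lam A (rename (fun | 0 => 0 | n + 1 => s n + 1) u)
  | _, zero => zero
  | s, succ n => succ (rename s n)
  | s, recur A a f n => recur A (rename s a) (rename s f) (rename s n)

/-- Lifting of a substitution under a binder. -/
def lift (σ : ℕ → Tm) : ℕ → Tm
  | 0 => var 0
  | n + 1 => (σ n).rename Nat.succ

/-- Simultaneous substitution. -/
def subst : (ℕ → Tm) → Tm → Tm
  | σ, var n => σ n
  | σ, app u v => app (subst σ u) (subst σ v)
  | σ, lam A u => lam A (subst (lift σ) u)
  | _, zero => zero
  | σ, succ n => succ (subst σ n)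
  | σ, recur A a f n => recur A (subst σ a) (subst σ f) (subst σ n)

/-- The substitution `(v/x)` for the last bound variable `x`. -/
def inst (v : Tm) : ℕ → Tm
  | 0 => v
  | n + 1 => var n

/-- One-step reduction of System T: closure under all contexts of the rule `β` and of
`Rec(a, f, 0) → a` and `Rec(a, f, S(b)) → (f b Rec(a, f, b))`. -/
inductive Step : Tm → Tm → Prop
  | beta (A : Ty) (u v : Tm) : Step (app (lam A u) v) (u.subst (inst v))
  | recur_zero (A : Ty) (a f : Tm) : Step (recur A a f zero) a
  | recur_succ (A : Ty) (a f b : Tm) :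
      Step (recur A a f (succ b)) (app (app f b) (recur A a f b))
  | app_left {u u' : Tm} (v : Tm) : Step u u' → Step (app u v) (app u' v)
  | app_right (u : Tm) {v v' : Tm} : Step v v' → Step (app u v) (app u v')
  | lam_congr (A : Ty) {u u' : Tm} : Step u u' → Step (lam A u) (lam A u')
  | succ_congr {n n' : Tm} : Step n n' → Step (succ n) (succ n')
  | recur_fst (A : Ty) {a a' : Tm} (f n : Tm) :
      Step a a' → Step (recur A a f n) (recur A a' f n)
  | recur_snd (A : Ty) (a : Tm) {f f' : Tm} (n : Tm) :
      Step f f' → Step (recur A a f n) (recur A a f' n)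
  | recur_thd (A : Ty) (a f : Tm) {n n' : Tm} :
      Step n n' → Step (recur A a f n) (recur A a f n')

end Tm

/-- `HasType Γ t A`: the term `t` of System T has type `A` in the context `Γ`. -/
inductive HasType : List Ty → Tm → Ty → Prop
  | var {Γ : List Ty} {n : ℕ} {A : Ty} : Γ[n]? = some A → HasType Γ (.var n) A
  | app {Γ : List Ty} {u v : Tm} {A B : Ty} :
      HasType Γ u (.arr A B) → HasType Γ v A → HasType Γ (.app u v) B
  | lam {Γ : List Ty} {u : Tm} {A B : Ty} :
      HasType (A :: Γ) u B → HasType Γ (.lam A u) (.arr A B)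
  | zero {Γ : List Ty} : HasType Γ .zero .nat
  | succ {Γ : List Ty} {n : Tm} : HasType Γ n .nat → HasType Γ (.succ n) .nat
  | recur {Γ : List Ty} {A : Ty} {a f n : Tm} :
      HasType Γ a A → HasType Γ f (.arr .nat (.arr A A)) → HasType Γ n .nat →
      HasType Γ (.recur A a f n) A

open TheoryT

/-- Types of System T are (closed) terms of the theory. -/
def Ty.toTerm : Ty → Term
  | .nat => .nat
  | .arr A B => .arr A.toTerm B.toTerm

/-- The proposition `ε(A)` for a type `A`. -/
def Ty.eps (A : Ty) : Form := .eps A.toTerm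

/-- The proof-term `λ p. λ x : ε(p). λ f : ε(nat) ⇒ ε(p) ⇒ ε(p). π`. -/
def numeralAbs (π : Proof) : Proof :=
  .tlam (.lam (.eps (.var 0)) (.lam (Form.stepForm (.var 0)) π))

/-- The translation `|t|` of terms of System T to proof-terms, with Parigot numerals.
The variable `x` keeps its number; in `|S(n)|` the translation of `n` is moved under the
binders of `p`, `x` and `f`. -/
def Tm.translate : Tm → Proof
  | .var n => .var n
  | .app u v => .app u.translate v.translate
  | .lam A u => .lam A.eps u.translate
  | .zero => numeralAbs (.var 1)
  | .succ n =>
      let ν := n.translate.rename Term.shift (fun k => k + 2)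
      numeralAbs (.app (.app (.var 0) ν) (.app (.app (.tapp ν (.var 0)) (.var 1)) (.var 0)))
  | .recur A a f n => .app (.app (.tapp n.translate A.toTerm) a.translate) f.translate

end SystemT

namespace SystemT

open TheoryT (Proof)

namespace Tm

/-! ### Renaming and substitution in System T -/

theorem rename_lam (s : ℕ → ℕ) (A : Ty) (u : Tm) :
    (lam A u).rename s = .lam A (u.rename (Proof.liftRen s)) := by
  have h : (fun | 0 => 0 | n + 1 => s n + 1 : ℕ → ℕ) = Proof.liftRen s := by
    funext n; cases n <;> rfl
  exact congrArg (fun r => lam A (u.rename r)) h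

theorem liftRen_comp (s r : ℕ → ℕ) :
    (fun n => Proof.liftRen r (Proof.liftRen s n)) = Proof.liftRen (fun n => r (s n)) := by
  funext n; cases n <;> rfl

theorem rename_rename (s r : ℕ → ℕ) (t : Tm) :
    (t.rename s).rename r = t.rename (fun n => r (s n)) := by
  induction t generalizing s r with
  | lam A u ih => simp only [rename_lam, ih, liftRen_comp]
  | _ => simp_all [rename]

theorem lift_liftRen (s : ℕ → ℕ) (σ : ℕ → Tm) :
    (fun n => lift σ (Proof.liftRen s n)) = lift (fun n => σ (s n)) := by
  funext n; cases n <;> rfl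

theorem rename_subst (s : ℕ → ℕ) (σ : ℕ → Tm) (t : Tm) :
    (t.rename s).subst σ = t.subst (fun n => σ (s n)) := by
  induction t generalizing s σ with
  | lam A u ih => simp only [rename_lam, subst, ih, lift_liftRen]
  | _ => simp_all [rename, subst]

theorem rename_lift (σ : ℕ → Tm) (s : ℕ → ℕ) :
    (fun n => (lift σ n).rename (Proof.liftRen s)) = lift (fun n => (σ n).rename s) := by
  funext n
  cases n with
  | zero => rfl
  | succ n => simp only [lift, rename_rename]; rfl

theorem subst_rename (σ : ℕ → Tm) (s : ℕ → ℕ) (t : Tm) :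
    (t.subst σ).rename s = t.subst (fun n => (σ n).rename s) := by
  induction t generalizing σ s with
  | lam A u ih => simp only [rename_lam, subst, ih, rename_lift]
  | _ => simp_all [rename, subst]

theorem subst_lift (σ ρ : ℕ → Tm) :
    (fun n => (lift σ n).subst (lift ρ)) = lift (fun n => (σ n).subst ρ) := by
  funext n
  cases n with
  | zero => rfl
  | succ n => simp only [lift, rename_subst, subst_rename]

theorem subst_subst (σ ρ : ℕ → Tm) (t : Tm) :
    (t.subst σ).subst ρ = t.subst (fun n => (σ n).subst ρ) := by
  induction t generalizing σ ρ with
  | lam A u ih => simp only [subst, ih, subst_lift]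
  | _ => simp_all [subst]

theorem lift_var : lift var = var := by
  funext n; cases n <;> rfl

theorem subst_var (t : Tm) : t.subst var = t := by
  induction t with
  | lam A u ih => simp only [subst, lift_var, ih]
  | _ => simp_all [subst]

theorem rename_eq_subst (s : ℕ → ℕ) (t : Tm) : t.rename s = t.subst (fun n => var (s n)) := by
  rw [← subst_var (t.rename s), rename_subst]

theorem subst_inst (u v : Tm) (σ : ℕ → Tm) :
    (u.subst (inst v)).subst σ = (u.subst (lift σ)).subst (inst (v.subst σ)) := by
  simp only [subst_subst]
  congr 1
  funext n
  cases n with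
  | zero => rfl
  | succ n => simp only [inst, lift, subst, rename_subst, subst_var]

theorem Step.subst {t u : Tm} (h : Step t u) (σ : ℕ → Tm) : Step (t.subst σ) (u.subst σ) := by
  induction h generalizing σ with
  | beta A u v => rw [subst_inst]; exact .beta _ _ _
  | recur_zero A a f => exact .recur_zero _ _ _
  | recur_succ A a f b => exact .recur_succ _ _ _ _
  | app_left v _ ih => exact .app_left _ (ih σ)
  | app_right u _ ih => exact .app_right _ (ih σ)
  | lam_congr A _ ih => exact .lam_congr _ (ih _)
  | succ_congr _ ih => exact .succ_congr (ih σ)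
  | recur_fst A f n _ ih => exact .recur_fst _ _ _ (ih σ)
  | recur_snd A a n _ ih => exact .recur_snd _ _ _ (ih σ)
  | recur_thd A a f _ ih => exact .recur_thd _ _ _ (ih σ)

theorem rename_id (t : Tm) : t.rename id = t := by
  rw [rename_eq_subst]; exact subst_var t

end Tm

/-! ### The translation commutes with renaming and substitution -/

theorem Ty.toTerm_subst (A : Ty) (τ : ℕ → TheoryT.Term) : A.toTerm.subst τ = A.toTerm := by
  induction A <;> simp_all [Ty.toTerm, TheoryT.Term.subst]

theorem Ty.eps_subst (A : Ty) (τ : ℕ → TheoryT.Term) : A.eps.subst τ = A.eps := by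
  simp [Ty.eps, TheoryT.Form.subst, A.toTerm_subst]

theorem Tm.translate_rename_rename (t : Tm) (r : ℕ → ℕ) (τ : ℕ → TheoryT.Term) (s : ℕ → ℕ) :
    (t.rename r).translate.rename τ s = (t.rename fun n => s (r n)).translate := by
  induction t generalizing r τ s with
  | var n => rfl
  | zero => rfl
  | app u v ihu ihv => simp only [translate, Proof.rename, rename, ihu, ihv]
  | lam A u ih =>
    simp only [rename_lam, translate, Proof.rename, ih, Ty.eps_subst, liftRen_comp]
  | succ n ih =>
    simp only [translate, numeralAbs, rename, Proof.rename, ih, TheoryT.Form.subst,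
      TheoryT.Form.stepForm, TheoryT.Term.subst, Proof.liftRen, TheoryT.Term.lift]
  | recur A a f n iha ihf ihn =>
    simp only [translate, Proof.rename, rename, iha, ihf, ihn, Ty.toTerm_subst]

/-- The translation of a term contains no free term variable. -/
theorem Tm.translate_rename (t : Tm) (τ : ℕ → TheoryT.Term) (s : ℕ → ℕ) :
    t.translate.rename τ s = (t.rename s).translate := by
  simpa only [rename_id, id] using translate_rename_rename t id τ s

theorem Tm.translate_succ (n : Tm) :
    (succ n).translate = numeralAbs (.app (.app (.var 0) (n.rename (fun k => k + 2)).translate)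
      (.app (.app (.tapp (n.rename (fun k => k + 2)).translate (.var 0)) (.var 1)) (.var 0))) := by
  simp only [translate, translate_rename]

theorem Tm.translate_lift (σ : ℕ → Tm) :
    Proof.lift (fun n => (σ n).translate) = fun n => (lift σ n).translate := by
  funext n
  cases n with
  | zero => rfl
  | succ n => exact translate_rename _ _ _

theorem Tm.translate_tlift (σ : ℕ → Tm) :
    Proof.tlift (fun n => (σ n).translate) = fun n => (σ n).translate := by
  funext n
  simp only [Proof.tlift, translate_rename, rename_eq_subst]
  exact congrArg translate (subst_var _)

theorem Tm.translate_rename_subst (t : Tm) (s : ℕ → ℕ) (τ : ℕ → TheoryT.Term) (σ : ℕ → Tm) :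
    (t.rename s).translate.subst τ (fun n => (σ n).translate) =
      (t.subst fun n => σ (s n)).translate := by
  induction t generalizing s τ σ with
  | var n => rfl
  | zero => rfl
  | app u v ihu ihv => simp only [translate, rename, Proof.subst, subst, ihu, ihv]
  | lam A u ih =>
    simp only [rename_lam, subst, translate, Proof.subst, translate_lift, ih, Ty.eps_subst,
      lift_liftRen]
  | succ n ih =>
    have h : (n.subst fun k => σ (s k)).rename (fun k => k + 2) =
        n.subst fun k => lift (lift σ) (s k + 2) := by
      rw [subst_rename]
      simp only [lift, rename_rename]
    rw [rename, subst, translate_succ, translate_succ, rename_rename, h]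
    simp only [numeralAbs, Proof.subst, translate_tlift, translate_lift, ih, TheoryT.Form.subst,
      TheoryT.Form.stepForm, TheoryT.Term.subst, TheoryT.Term.lift]
    rfl
  | recur A a f n iha ihf ihn =>
    simp only [translate, rename, Proof.subst, subst, iha, ihf, ihn, Ty.toTerm_subst]

theorem Tm.translate_subst (t : Tm) (τ : ℕ → TheoryT.Term) (σ : ℕ → Tm) :
    t.translate.subst τ (fun n => (σ n).translate) = (t.subst σ).translate := by
  simpa only [rename_id, id] using translate_rename_subst t id τ σ

theorem Tm.inst_translate (v : Tm) :
    Proof.inst v.translate = fun n => (inst v n).translate := by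
  funext n; cases n <;> rfl

theorem Tm.translate_inst (u v : Tm) (τ : ℕ → TheoryT.Term) :
    u.translate.subst τ (Proof.inst v.translate) = (u.subst (inst v)).translate := by
  rw [inst_translate, translate_subst]

/-! ### Typing of the translation -/

open TheoryT in
theorem Form.Equiv.eps_nat : Form.Equiv (.eps .nat) Form.natForm := .rel _ _ .nat

open TheoryT in
/-- A variable of the renamed term may be declared anywhere in the context of the translation. -/
theorem HasType.proves_rename {Γ : List Ty} {t : Tm} {A : Ty} (h : HasType Γ t A)
    (s : ℕ → ℕ) (Δ : List Form) (hs : ∀ n A, Γ[n]? = some A → Δ[s n]? = some A.eps) :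
    Proves Δ (t.rename s).translate A.eps := by
  induction h generalizing s Δ with
  | var h => exact .ax (hs _ _ h) (.refl _)
  | app _ _ ihu ihv => exact .imp_elim (ihu s Δ hs) (ihv s Δ hs) (.rel _ _ (.arr _ _))
  | lam _ ih =>
    rw [Tm.rename_lam]
    refine .imp_intro (ih _ _ fun n A h => ?_) (.rel _ _ (.arr _ _))
    cases n with
    | zero => simpa [Proof.liftRen] using congrArg Ty.eps (Option.some.inj h)
    | succ n => exact hs n A (by simpa using h)
  | zero =>
    exact .all_intro (.imp_intro (.imp_intro (.ax rfl (.refl _)) (.refl _)) (.refl _))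
      Form.Equiv.eps_nat
  | @succ Γ n _ ih =>
    rw [Tm.rename, Tm.translate_succ, Tm.rename_rename]
    have hn := ih (fun k => s k + 2)
      (Form.stepForm (.var 0) :: .eps (.var 0) :: Δ.map Form.shift) (fun k A h => by
        simpa [Form.shift, hs k A h] using A.eps_subst _)
    refine .all_intro (.imp_intro (.imp_intro ?_ (.refl _)) (.refl _)) Form.Equiv.eps_nat
    refine .imp_elim (.imp_elim (.ax rfl (.refl _)) hn (.refl _)) ?_ (.refl _)
    exact .imp_elim (.imp_elim (.all_elim hn Form.Equiv.eps_nat (.refl _))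
      (.ax rfl (.refl _)) (.refl _)) (.ax rfl (.refl _)) (.refl _)
  | @recur Γ A a f n _ _ _ iha ihf ihn =>
    have h₁ := Proves.all_elim (t := A.toTerm) (ihn s Δ hs) Form.Equiv.eps_nat
      (C := .imp A.eps (.imp (.eps (.arr .nat (.arr A.toTerm A.toTerm))) A.eps))
      (.trans _ _ _ (.rel _ _ (.imp_right _ (.imp_left _ (.arr _ _))))
        (.rel _ _ (.imp_right _ (.imp_left _ (.imp_right _ (.arr _ _))))))
    exact .imp_elim (.imp_elim h₁ (iha s Δ hs) (.refl _)) (ihf s Δ hs) (.refl _)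

open TheoryT in
theorem HasType.proves {Γ : List Ty} {t : Tm} {A : Ty} (h : HasType Γ t A) :
    Proves (Γ.map Ty.eps) t.translate A.eps := by
  have := h.proves_rename id (Γ.map Ty.eps) (fun n A h => by simp [h])
  rwa [Tm.rename_eq_subst, show (fun n => Tm.var (id n)) = Tm.var from rfl, Tm.subst_var] at this

/-! ### Simulation of the reduction -/

open Relation in
theorem Tm.translate_recur_zero (A : Ty) (a f : Tm) :
    TransGen Proof.Step (recur A a f zero).translate a.translate := by
  refine .head (.app_left _ (.app_left _ (.tbeta _ _))) ?_
  refine .head (.app_left _ (.beta _ _ _)) (.single ?_)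
  have ha : (a.rename Nat.succ).subst (inst f) = a := by
    rw [rename_subst]; exact subst_var a
  have h := Proof.Step.beta (TheoryT.Form.stepForm A.toTerm)
    (a.rename Nat.succ).translate f.translate
  rw [translate_inst, ha] at h
  simpa only [← translate_rename _ TheoryT.Term.var Nat.succ, TheoryT.Form.subst,
    TheoryT.Form.stepForm, TheoryT.Term.subst, TheoryT.Term.inst, Ty.toTerm_subst, Proof.subst,
    Proof.lift, Proof.inst, Proof.rename] using h

open Relation in
theorem Tm.translate_recur_succ (A : Ty) (a f b : Tm) :
    TransGen Proof.Step (recur A a f (succ b)).translate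
      (app (app f b) (recur A a f b)).translate := by
  have hb : ((b.rename (fun k => k + 2)).subst (lift (inst a))).subst (inst f) = b := by
    simp only [rename_subst, subst_subst, lift, inst, rename, subst, subst_var]
  have ha : (a.rename Nat.succ).subst (inst f) = a := by
    rw [rename_subst]; exact subst_var a
  have hvar : Proof.var = fun n => (var n).translate := rfl
  simp only [translate, translate_rename]
  refine .head (.app_left _ (.app_left _ (.tbeta _ _))) ?_
  refine .head (.app_left _ (.beta _ _ _)) (.single ?_)
  have h := Proof.Step.beta (TheoryT.Form.stepForm A.toTerm)
    (.app (.app (.var 0) ((b.rename fun k => k + 2).subst (lift (inst a))).translate)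
      (.app (.app (.tapp ((b.rename fun k => k + 2).subst (lift (inst a))).translate A.toTerm)
        (a.rename Nat.succ).translate) (.var 0))) f.translate
  simp only [Proof.subst, translate_inst, hb, ha, Ty.toTerm_subst] at h
  simp only [Proof.subst]
  simp only [inst_translate, hvar, translate_lift, lift_var, translate_subst,
    subst_var]
  simpa only [lift, inst, subst, rename, translate, TheoryT.Term.subst, TheoryT.Term.inst,
    TheoryT.Form.subst, TheoryT.Form.stepForm, Ty.toTerm_subst, Proof.inst] using h

open Relation in
theorem Tm.Step.translate {t u : Tm} (h : Step t u) :
    TransGen Proof.Step t.translate u.translate := by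
  suffices H : ∀ s, TransGen Proof.Step (t.rename s).translate (u.rename s).translate by
    simpa only [rename_id] using H id
  induction h with
  | beta A u v =>
    intro s
    simp only [rename_eq_subst, subst_inst]
    refine .single ?_
    rw [← translate_inst _ _ TheoryT.Term.var]
    exact .beta _ _ _
  | recur_zero A a f => exact fun s => translate_recur_zero _ _ _
  | recur_succ A a f b => exact fun s => translate_recur_succ _ _ _ _
  | app_left v _ ih => exact fun s => (ih s).lift (Proof.app · _) fun _ _ => .app_left _
  | app_right u _ ih => exact fun s => (ih s).lift (Proof.app _) fun _ _ => .app_right _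
  | lam_congr A _ ih =>
    intro s
    simp only [rename_lam]
    exact (ih _).lift (Proof.lam _) fun _ _ => .lam_congr _
  | succ_congr _ ih =>
    intro s
    simp only [Tm.rename, translate_succ, rename_rename]
    have h := ih (fun k => s k + 2)
    have lift₃ {π ρ : Proof} (h : TransGen Proof.Step π ρ) :
        TransGen Proof.Step (numeralAbs π) (numeralAbs ρ) :=
      h.lift numeralAbs fun _ _ h => .tlam_congr (.lam_congr _ (.lam_congr _ h))
    exact .trans
      (lift₃ (h.lift (fun π => Proof.app (.app (.var 0) π) _) fun _ _ h => .app_left _ (.app_right _ h)))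
      (lift₃ (h.lift (fun π => Proof.app _ (.app (.app (.tapp π (.var 0)) (.var 1)) (.var 0)))
        fun _ _ h => .app_right _ (.app_left _ (.app_left _ (.tapp_congr _ h)))))
  | recur_fst A f n _ ih =>
    exact fun s => (ih s).lift (fun π => Proof.app (.app _ π) _)
      fun _ _ h => .app_left _ (.app_right _ h)
  | recur_snd A a n _ ih => exact fun s => (ih s).lift (Proof.app _) fun _ _ => .app_right _
  | recur_thd A a f _ ih =>
    exact fun s => (ih s).lift (fun π => Proof.app (.app (.tapp π _) _) _)
      fun _ _ h => .app_left _ (.app_left _ (.tapp_congr _ h))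

theorem Tm.stronglyNormalizing_of_translate (t : Tm)
    (h : StronglyNormalizing Proof.Step t.translate) : StronglyNormalizing Step t := by
  have h' : Acc (Relation.TransGen fun b a => Proof.Step a b) t.translate := Acc.transGen h
  have h'' := InvImage.accessible translate h'
  refine Subrelation.accessible (fun {b a} hab => ?_) h''
  exact Relation.transGen_swap.mp hab.translate

/-! ### Reducibility -/

/-- Well-foundedness for the relation whose steps are one-step reduction and the passage from
`S(b)` to `b`: reducibility at type `nat`. -/
inductive RedNat : Tm → Prop
  | intro {t : Tm} : (∀ t', Tm.Step t t' → RedNat t') → (∀ b, t = .succ b → RedNat b) → RedNat t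

/-- Tait's reducibility predicate. -/
def Red : Ty → Tm → Prop
  | .nat, t => RedNat t
  | .arr A B, t => ∀ u, Red A u → Red B (.app t u)

/-- Terms that are not introductions. -/
def Tm.Neutral : Tm → Prop
  | .var _ | .app _ _ | .recur _ _ _ _ => True
  | _ => False

theorem RedNat.stronglyNormalizing {t : Tm} (h : RedNat t) : StronglyNormalizing Tm.Step t := by
  induction h with
  | intro _ _ ih _ => exact ⟨_, ih⟩

theorem RedNat.zero : RedNat .zero := .intro (by rintro _ ⟨⟩) (by rintro _ ⟨⟩)

theorem RedNat.succ {t : Tm} (h : RedNat t) : RedNat (.succ t) := by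
  induction h with
  | intro h₁ h₂ ih _ =>
    refine .intro ?_ ?_
    · rintro _ (_ | _)
      exact ih _ ‹_›
    · rintro _ ⟨⟩
      exact .intro h₁ h₂

theorem Red.step {A : Ty} {t t' : Tm} (h : Red A t) (hs : Tm.Step t t') : Red A t' := by
  induction A generalizing t t' with
  | nat => cases h with | intro h _ => exact h _ hs
  | arr A B _ ih => exact fun u hu => ih (h u hu) (.app_left _ hs)

theorem stronglyNormalizing_of_subst {t : Tm} {σ : ℕ → Tm}
    (h : StronglyNormalizing Tm.Step (t.subst σ)) : StronglyNormalizing Tm.Step t :=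
  Subrelation.accessible (fun {_ _} hab => Tm.Step.subst hab σ)
    (InvImage.accessible (Tm.subst σ) h)

theorem stronglyNormalizing_of_app {t u : Tm}
    (h : StronglyNormalizing Tm.Step (.app t u)) : StronglyNormalizing Tm.Step t :=
  Subrelation.accessible (fun {_ _} hab => Tm.Step.app_left u hab)
    (InvImage.accessible (fun t => Tm.app t u) h)

theorem red_candidate (A : Ty) : (∀ t, Red A t → StronglyNormalizing Tm.Step t) ∧
    ∀ t : Tm, t.Neutral → (∀ t', Tm.Step t t' → Red A t') → Red A t := by
  induction A with
  | nat =>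
    refine ⟨fun t h => h.stronglyNormalizing, fun t ht h => .intro h ?_⟩
    rintro b rfl
    exact ht.elim
  | arr A B ihA ihB =>
    refine ⟨fun t h => ?_, fun t ht h u hu => ?_⟩
    · have h₀ : Red A (.var 0) := ihA.2 _ trivial (by rintro _ ⟨⟩)
      exact stronglyNormalizing_of_app (ihB.1 _ (h _ h₀))
    · have hsn := ihA.1 u hu
      induction hsn with
      | intro u _ ih =>
        refine ihB.2 _ trivial ?_
        intro t' hs
        cases hs with
        | beta => exact ht.elim
        | app_left _ hs => exact h _ hs _ hu
        | app_right _ hs => exact ih _ hs (hu.step hs)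

theorem Red.stronglyNormalizing {A : Ty} {t : Tm} (h : Red A t) : StronglyNormalizing Tm.Step t :=
  (red_candidate A).1 t h

theorem Red.of_neutral {A : Ty} {t : Tm} (ht : t.Neutral) (h : ∀ t', Tm.Step t t' → Red A t') :
    Red A t :=
  (red_candidate A).2 t ht h

theorem Red.var (A : Ty) (n : ℕ) : Red A (.var n) := .of_neutral trivial (by rintro _ ⟨⟩)

theorem Red.lam {A B C : Ty} {u : Tm} (h : ∀ v, Red A v → Red B (u.subst (Tm.inst v))) :
    Red (.arr A B) (.lam C u) := by
  intro v hv
  have hu : StronglyNormalizing Tm.Step u :=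
    stronglyNormalizing_of_subst (h v hv).stronglyNormalizing
  induction hu generalizing v with
  | intro u _ ihu =>
    have hsv := hv.stronglyNormalizing
    induction hsv with
    | intro v _ ihv =>
      refine .of_neutral trivial fun t' hs => ?_
      cases hs with
      | beta => exact h v hv
      | app_left _ hs =>
        cases hs with
        | lam_congr _ hs => exact ihu _ hs (fun v hv => (h v hv).step (hs.subst _)) v hv
      | app_right _ hs => exact ihv _ hs (hv.step hs)

theorem Red.recur {A C : Ty} {a f n : Tm} (ha : Red A a) (hf : Red (.arr .nat (.arr A A)) f)
    (hn : RedNat n) : Red A (.recur C a f n) := by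
  induction hn generalizing a f with
  | @intro n hn₁ hn₂ ihs ihp =>
    have hsa := ha.stronglyNormalizing
    induction hsa generalizing f with
    | intro a _ iha =>
      have hsf := hf.stronglyNormalizing
      induction hsf with
      | intro f _ ihf =>
        refine .of_neutral trivial fun t' hs => ?_
        cases hs with
        | recur_zero => exact ha
        | recur_succ => exact hf _ (hn₂ _ rfl) _ (ihp _ rfl ha hf)
        | recur_fst _ _ _ hs => exact iha _ hs (ha.step hs) hf
        | recur_snd _ _ _ hs => exact ihf _ hs (hf.step hs)
        | recur_thd _ _ _ hs => exact ihs _ hs ha hf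

theorem HasType.red_subst {Γ : List Ty} {t : Tm} {A : Ty} (h : HasType Γ t A) (σ : ℕ → Tm)
    (hσ : ∀ n A, Γ[n]? = some A → Red A (σ n)) : Red A (t.subst σ) := by
  induction h generalizing σ with
  | var h => exact hσ _ _ h
  | app _ _ ihu ihv => exact ihu σ hσ _ (ihv σ hσ)
  | lam _ ih =>
    refine Red.lam fun v hv => ?_
    rw [Tm.subst_subst]
    refine ih _ fun n B h => ?_
    cases n with
    | zero => obtain rfl : _ = B := by simpa using h
              exact hv
    | succ n =>
      simp only [Tm.lift, Tm.rename_subst]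
      exact (Tm.subst_var (σ n)).symm ▸ hσ n B (by simpa using h)
  | zero => exact RedNat.zero
  | succ _ ih => exact RedNat.succ (ih σ hσ)
  | recur _ _ _ iha ihf ihn => exact Red.recur (iha σ hσ) (ihf σ hσ) (ihn σ hσ)

theorem HasType.stronglyNormalizing {Γ : List Ty} {t : Tm} {A : Ty} (h : HasType Γ t A) :
    StronglyNormalizing Tm.Step t := by
  have := h.red_subst .var fun n A _ => Red.var A n
  rw [Tm.subst_var] at this
  exact this.stronglyNormalizing

end SystemT

theorem mainTheorem5 :
    -- typed terms of System T translate to proofs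
    (∀ (Γ : List SystemT.Ty) (t : SystemT.Tm) (A : SystemT.Ty),
      SystemT.HasType Γ t A → TheoryT.Proves (Γ.map SystemT.Ty.eps) t.translate A.eps) ∧
    -- every reduction step becomes at least one step of proof reduction
    (∀ t u : SystemT.Tm, SystemT.Tm.Step t u →
      Relation.TransGen TheoryT.Proof.Step t.translate u.translate) ∧
    -- hence termination of the translation implies termination of the term
    (∀ t : SystemT.Tm, StronglyNormalizing TheoryT.Proof.Step t.translate →
      StronglyNormalizing SystemT.Tm.Step t) ∧
    -- normalization of the theory implies normalization of System T
    ((∀ (Γ : List TheoryT.Form) (π : TheoryT.Proof) (A : TheoryT.Form),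
        TheoryT.Proves Γ π A → StronglyNormalizing TheoryT.Proof.Step π) →
      ∀ (Γ : List SystemT.Ty) (t : SystemT.Tm) (A : SystemT.Ty),
        SystemT.HasType Γ t A → StronglyNormalizing SystemT.Tm.Step t) ∧
    -- System T is strongly normalizing
    (∀ (Γ : List SystemT.Ty) (t : SystemT.Tm) (A : SystemT.Ty),
      SystemT.HasType Γ t A → StronglyNormalizing SystemT.Tm.Step t) :=
  ⟨fun _ _ _ h => h.proves, fun _ _ h => h.translate,
    fun t h => t.stronglyNormalizing_of_translate h,
    fun h _ t _ ht => t.stronglyNormalizing_of_translate (h _ _ _ ht.proves),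
    fun _ _ _ h => h.stronglyNormalizing⟩
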